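/- A variety of lattices is the class of all lattices satisfying a given set of lattice identities; it is called non-distributive if it contains a non-distributive lattice. For a variety $\mathcal V$ of lattices, a free bounded lattice in $\mathcal V$ on a set $X$ of generators is a bounded lattice $F\in\mathcal V$ with a map $X\to F$ such that every map from $X$ to a bounded lattice $L\in\mathcal V$ extends uniquely to a lattice homomorphism $F\to L$ preserving $0$ and $1$. For a lattice $L$, let $\mathrm{Con}_c\,L$ be the $\{\vee,0\}$-semilattice of all compact congruences of $L$, and let $\Theta(a,b)$ be the least congruence of $L$ that identifies $a$ and $b$. Let $S$ be a $\{\vee,0\}$-semilattice and let $\varepsilon\in S$. We say that $S$ satisfies $\mathrm{URP}_1^-$ at $\varepsilon$ if for every set $I$ and every family $\langle\langle\alpha_i,\beta_i\rangle\mid i\in I\rangle$ of elements of $S\times S$ such that $\alpha_i\vee\beta_i=\varepsilon$ for all $i\in I$, there exist a subset $X$ of $I$, a family $\langle\langle\alpha_i^*,\beta_i^*\rangle\mid i\in I\rangle$ of elements of $S\times S$ and a family $\langle\gamma_{i,j}\mid\langle i,j\rangle\in I\times I\rangle$ of elements of $S$ such that for all $i,j,k\in I$: (i) $\alpha_i^*\le\alpha_i$,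 $\beta_i^*\le\beta_i$, and $\alpha_i^*\vee\beta_i^*=\varepsilon$; (ii) $\gamma_{i,j}\le\alpha_i^*$ and $\gamma_{i,j}\le\beta_j^*$; (iii) $\alpha_i^*\le\alpha_j^*\vee\gamma_{i,j}$ and $\beta_j^*\le\beta_i^*\vee\gamma_{i,j}$; (iv) $\gamma_{i,k}\le\gamma_{i,j}\vee\gamma_{j,k}$ whenever both implications $\{i,k\}\subseteq X\Rightarrow j\in X$ and $\{i,k\}\subseteq I\setminus X\Rightarrow j\in I\setminus X$ hold. Theorem. Let $\mathcal V$ be a non-distributive variety of lattices and let $F$ be a free bounded lattice in $\mathcal V$ on at least $\aleph_2$ generators. Then $\Theta(0,1)$ is the largest congruence of $F$, and $\mathrm{Con}_c\,F$ does not satisfy $\mathrm{URP}_1^-$ at $\Theta(0,1)$. -/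

import Mathlib

universe u

/-! ### Lattice terms, identities and varieties -/

/-- Lattice terms over a set `V` of variables. -/
inductive LatTerm (V : Type u) : Type u
  | var : V → LatTerm V
  | inf : LatTerm V → LatTerm V → LatTerm V
  | sup : LatTerm V → LatTerm V → LatTerm V

/-- The value of a lattice term in a lattice under an assignment of the variables. -/
def LatTerm.eval {V : Type*} {L : Type*} [Lattice L] (v : V → L) : LatTerm V → L
  | .var x => v x
  | .inf s t => s.eval v ⊓ t.eval v
  | .sup s t => s.eval v ⊔ t.eval v

/-- A lattice identity `p ≈ q`, in countably many variables, as the pair `(p, q)`. -/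
abbrev LatIdentity : Type := LatTerm ℕ × LatTerm ℕ

/-- A variety of lattices is the class of all lattices that satisfy a given set `E` of lattice
identities; `InVariety E L` says that `L` belongs to the variety defined by `E`. -/
def InVariety (E : Set LatIdentity) (L : Type*) [Lattice L] : Prop :=
  ∀ e ∈ E, ∀ v : ℕ → L, e.1.eval v = e.2.eval v

/-- The variety defined by `E` is non-distributive: it has a member that is not distributive. -/
def IsNonDistributiveVariety (E : Set LatIdentity) : Prop :=
  ∃ (L : Type u) (_ : Lattice L), InVariety E L ∧
    ¬ ∀ x y z : L, x ⊓ (y ⊔ z) = (x ⊓ y) ⊔ (x ⊓ z)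

/-- `F`, with the family of generators `gen : X → F`, is a free bounded lattice on `X` in the
variety defined by `E`: every map from `X` to a bounded lattice `L` in the variety extends
uniquely to a lattice homomorphism from `F` to `L` that preserves `0` and `1`. -/
def IsFreeBoundedLattice (E : Set LatIdentity) {X F : Type u} [Lattice F] [BoundedOrder F]
    (gen : X → F) : Prop :=
  InVariety E F ∧
    ∀ (L : Type u) [Lattice L] [BoundedOrder L], InVariety E L →
      ∀ f : X → L, ∃! g : BoundedLatticeHom F L, ∀ x, g (gen x) = f x

/-! ### The lattice of congruences of a lattice -/

namespace LatticeCon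

variable {L : Type*} [Lattice L]

theorem ext_r {θ φ : LatticeCon L} (h : ∀ x y, θ.r x y ↔ φ.r x y) : θ = φ := by
  obtain ⟨s, _, _⟩ := θ
  obtain ⟨t, _, _⟩ := φ
  have : s = t := Setoid.ext h
  subst this
  rfl

/-- Congruences are ordered by inclusion. -/
instance instPartialOrderCon : PartialOrder (LatticeCon L) where
  le θ φ := ∀ x y, θ.r x y → φ.r x y
  le_refl _ _ _ h := h
  le_trans _ _ _ h₁ h₂ x y h := h₂ x y (h₁ x y h)
  le_antisymm _ _ h₁ h₂ := ext_r fun x y => ⟨h₁ x y, h₂ x y⟩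

/-- The intersection of a set of congruences. -/
instance instInfSetCon : InfSet (LatticeCon L) where
  sInf S :=
    { r := fun x y => ∀ θ ∈ S, θ.r x y
      iseqv := ⟨fun x φ _ => φ.iseqv.refl x, fun h θ hθ => θ.iseqv.symm (h θ hθ),
        fun h₁ h₂ θ hθ => θ.iseqv.trans (h₁ θ hθ) (h₂ θ hθ)⟩
      inf := fun h₁ h₂ θ hθ => θ.inf (h₁ θ hθ) (h₂ θ hθ)
      sup := fun h₁ h₂ θ hθ => θ.sup (h₁ θ hθ) (h₂ θ hθ) }

theorem isGLB_sInf_con (S : Set (LatticeCon L)) : IsGLB S (sInf S) :=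
  ⟨fun _ hθ _ _ h => h _ hθ, fun _ hφ x y h _ hθ => hφ hθ x y h⟩

/-- The complete lattice `Con L` of all congruences of `L`. -/
instance instCompleteLatticeCon : CompleteLattice (LatticeCon L) :=
  completeLatticeOfInf (LatticeCon L) isGLB_sInf_con

/-- The principal congruence `Θ(a, b)`: the least congruence that identifies `a` and `b`. -/
def principal (a b : L) : LatticeCon L := sInf {θ : LatticeCon L | θ.r a b}

theorem principal_le_iff {a b : L} {θ : LatticeCon L} : principal a b ≤ θ ↔ θ.r a b :=
  ⟨fun h => h a b fun _ hφ => hφ, fun h _ _ hxy => hxy θ h⟩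

/-- Principal congruences are compact. -/
theorem isCompactElement_principal (a b : L) : IsCompactElement (principal a b) := by
  intro S u hne hdir hlub hle
  let W : LatticeCon L :=
    { r := fun x y => ∃ θ ∈ S, θ.r x y
      iseqv := by
        refine ⟨fun x => ?_, ?_, ?_⟩
        · obtain ⟨θ, hθ⟩ := hne
          exact ⟨θ, hθ, θ.iseqv.refl x⟩
        · rintro x y ⟨θ, hθ, h⟩
          exact ⟨θ, hθ, θ.iseqv.symm h⟩
        · rintro x y z ⟨θ, hθ, h⟩ ⟨φ, hφ, h'⟩
          obtain ⟨ψ, hψ, h₁, h₂⟩ := hdir θ hθ φ hφ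
          exact ⟨ψ, hψ, ψ.iseqv.trans (h₁ _ _ h) (h₂ _ _ h')⟩
      inf := by
        rintro w x y z ⟨θ, hθ, h⟩ ⟨φ, hφ, h'⟩
        obtain ⟨ψ, hψ, h₁, h₂⟩ := hdir θ hθ φ hφ
        exact ⟨ψ, hψ, ψ.inf (h₁ _ _ h) (h₂ _ _ h')⟩
      sup := by
        rintro w x y z ⟨θ, hθ, h⟩ ⟨φ, hφ, h'⟩
        obtain ⟨ψ, hψ, h₁, h₂⟩ := hdir θ hθ φ hφ
        exact ⟨ψ, hψ, ψ.sup (h₁ _ _ h) (h₂ _ _ h')⟩ }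
  have hu : u ≤ W := hlub.2 fun θ hθ _ _ h => ⟨θ, hθ, h⟩
  obtain ⟨θ, hθ, h⟩ := principal_le_iff.1 (hle.trans hu)
  exact ⟨θ, hθ, principal_le_iff.2 h⟩

end LatticeCon

/-- `Con_c L`: the set of all compact congruences of `L`. -/
def ConC (L : Type*) [Lattice L] : Type _ :=
  {θ : LatticeCon L // IsCompactElement θ}

namespace ConC

variable {L : Type*} [Lattice L]

theorem isCompactElement_sup_con {θ φ : LatticeCon L} (hθ : IsCompactElement θ)
    (hφ : IsCompactElement φ) : IsCompactElement (θ ⊔ φ) := by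
  intro S u hne hdir hlub hle
  obtain ⟨a, ha, h₁⟩ := hθ S u hne hdir hlub (le_sup_left.trans hle)
  obtain ⟨b, hb, h₂⟩ := hφ S u hne hdir hlub (le_sup_right.trans hle)
  obtain ⟨c, hc, hac, hbc⟩ := hdir a ha b hb
  exact ⟨c, hc, sup_le (h₁.trans hac) (h₂.trans hbc)⟩

/-- The join in `Con_c L` is the join of `Con L`. -/
instance instSemilatticeSupConC : SemilatticeSup (ConC L) :=
  Subtype.semilatticeSup fun _ _ hθ hφ => isCompactElement_sup_con hθ hφ

/-- The zero of `Con_c L` is the equality relation, the least congruence of `L`. -/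
instance instOrderBotConC : OrderBot (ConC L) where
  bot := ⟨⊥, fun _ _ hne _ _ _ => hne.elim fun a ha => ⟨a, ha, bot_le⟩⟩
  bot_le θ := (bot_le : (⊥ : LatticeCon L) ≤ θ.1)

/-- The principal congruence `Θ(a, b)` as an element of `Con_c L`. -/
def principal (a b : L) : ConC L :=
  ⟨LatticeCon.principal a b, LatticeCon.isCompactElement_principal a b⟩

end ConC

/-! ### The property `URP₁⁻` -/

/-- The join-semilattice with zero `S` satisfies `URP₁⁻` at the family `((α i, β i))_{i ∈ I}`,
where `α i ⊔ β i = ε` for all `i`. -/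
def SatisfiesURPOneMinusAtFamily {S : Type*} [SemilatticeSup S] [OrderBot S] (ε : S)
    {I : Type*} (α β : I → S) : Prop :=
  ∃ (X : Set I) (α' β' : I → S) (γ : I → I → S),
    (∀ i, α' i ≤ α i ∧ β' i ≤ β i ∧ α' i ⊔ β' i = ε) ∧
    (∀ i j, γ i j ≤ α' i ∧ γ i j ≤ β' j) ∧
    (∀ i j, α' i ≤ α' j ⊔ γ i j ∧ β' j ≤ β' i ⊔ γ i j) ∧
    (∀ i j k, ({i, k} ⊆ X → j ∈ X) ∧ ({i, k} ⊆ Xᶜ → j ∈ Xᶜ) →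
      γ i k ≤ γ i j ⊔ γ j k)

/-- `S` satisfies `URP₁⁻` at the element `ε`: it does so at every family of pairs of elements
of `S` whose joins are all equal to `ε`. -/
def SatisfiesURPOneMinusAt {S : Type u} [SemilatticeSup S] [OrderBot S] (ε : S) : Prop :=
  ∀ (I : Type u) (α β : I → S), (∀ i, α i ⊔ β i = ε) → SatisfiesURPOneMinusAtFamily ε α β

/-! Pair up the generators. Collapsing the inside of the `i`-th pair, or the two intervals outside
it, gives two congruences with join `Θ(0,1)`. Suppose `URP₁⁻` holds for these decompositions. Each
`γ i j` is compact, hence has finite support (`exists_support`), and with `ℵ₂` indices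
`exists_free_triple` yields `i, j, k`, each outside the support attached to the other two.

Non-distributivity gives a bounded `L` in the variety with `x ⊓ y = ⊥`, `y ⊔ z = ⊤` and `¬ x ≤ z`.
Send the three pairs to `(⊥, x)`, `(y, ⊤)`, `(⊥, z)` and all others to `(⊥, ⊥)`. Resetting the pair
outside the support does not affect whether a `γ` is killed. So `γ i j` and `γ j k` are killed
(`le_ker_of_inf_eq_bot`, `le_ker_of_sup_eq_top`), whereas `γ i k` is not (`not_le_ker_of_not_le`),
contradicting (iv). -/

open Cardinal

/-! ### Free triples for set mappings on pairs -/

/-- Kuratowski's free set theorem for pairs: a map from pairs of elements of a set of cardinality at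
least `ℵ₂` to finite subsets has a free triple. -/
theorem exists_free_triple {I : Type u} (hI : Cardinal.aleph 2 ≤ #I) (f : I → I → Finset I) :
    ∃ i j k, i ≠ j ∧ i ≠ k ∧ j ≠ k ∧ k ∉ f i j ∧ i ∉ f j k ∧ j ∉ f i k := by
  have h12 : Cardinal.aleph 1 < (Cardinal.aleph 2 : Cardinal.{u}) :=
    Cardinal.aleph_lt_aleph.2 (by norm_num)
  have h01 : ℵ₀ < (Cardinal.aleph 1 : Cardinal.{u}) := Cardinal.aleph0_lt_aleph_one
  -- Choose `k` outside all `f`-values on a set `A` of size `ℵ₁`, then `b ∈ A` outside all `f a k`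
  -- for `a` in a countably infinite `B ⊆ A`, and last `a ∈ B` outside the finite `f b k`.
  obtain ⟨A, hA⟩ := Cardinal.le_mk_iff_exists_set.1 (h12.le.trans hI)
  have hA0 : ℵ₀ ≤ #A := by rw [hA]; exact h01.le
  have hU : #(A ∪ ⋃ p : A × A, (f p.1 p.2 : Set I) : Set I) ≤ Cardinal.aleph 1 := by
    refine (Cardinal.mk_union_le _ _).trans (Cardinal.add_le_of_le h01.le hA.le ?_)
    refine (Cardinal.mk_iUnion_le _).trans ?_
    refine Cardinal.mul_le_of_le h01.le ?_ ?_
    · rw [← Cardinal.mul_def, Cardinal.mul_eq_self hA0, hA]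
    · exact ciSup_le' fun p => ((Cardinal.lt_aleph0_of_finite _).trans h01).le
  obtain ⟨k, hk⟩ : ∃ k, k ∉ (A ∪ ⋃ p : A × A, (f p.1 p.2 : Set I) : Set I) := by
    by_contra! h
    rw [Set.eq_univ_of_forall h, Cardinal.mk_univ] at hU
    exact (hU.trans_lt (h12.trans_le hI)).false
  rw [Set.mem_union, not_or, Set.mem_iUnion, not_exists] at hk
  obtain ⟨B, hBA, hB⟩ := Cardinal.le_mk_iff_exists_subset.1 hA0
  have hBc : B.Countable := Cardinal.le_aleph0_iff_set_countable.1 hB.le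
  have hBi : B.Infinite := Set.infinite_coe_iff.1 (Cardinal.infinite_iff.2 hB.ge)
  have hC : (B ∪ ⋃ a ∈ B, (f a k : Set I)).Countable :=
    hBc.union (hBc.biUnion fun a _ => (f a k).countable_toSet)
  obtain ⟨b, hbA, hb⟩ : ∃ b ∈ A, b ∉ B ∪ ⋃ a ∈ B, (f a k : Set I) := by
    by_contra! h
    have := Cardinal.le_aleph0_iff_set_countable.2 (hC.mono h)
    rw [hA] at this
    exact (this.trans_lt h01).false
  simp only [Set.mem_union, Set.mem_iUnion, not_or, not_exists] at hb
  obtain ⟨a, haB, ha⟩ := (hBi.sdiff (f b k).finite_toSet).nonempty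
  have haA := hBA haB
  exact ⟨a, b, k, fun h => hb.1 (h ▸ haB), fun h => hk.1 (h ▸ haA), fun h => hk.1 (h ▸ hbA),
    hk.2 (⟨a, haA⟩, ⟨b, hbA⟩), ha, hb.2 a haB⟩

/-! ### Non-distributive lattices and varieties -/

/-- A lattice that satisfies the cut rule is distributive. -/
theorem inf_sup_eq_of_cut {L : Type*} [Lattice L]
    (h : ∀ x y z : L, x ⊓ y ≤ z → x ≤ y ⊔ z → x ≤ z) (x y z : L) :
    x ⊓ (y ⊔ z) = (x ⊓ y) ⊔ (x ⊓ z) := by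
  refine le_antisymm ?_ le_inf_sup
  have hy : x ⊓ (y ⊔ z) ⊓ y ≤ x ⊓ y := inf_le_inf_right _ inf_le_left
  have hz : x ⊓ (y ⊔ z) ⊓ z ≤ x ⊓ z := inf_le_inf_right _ inf_le_left
  refine h _ y _ (hy.trans le_sup_left) (h _ z _ ?_ ?_)
  · exact hz.trans (le_sup_right.trans le_sup_right)
  · exact inf_le_right.trans (sup_le (le_sup_left.trans le_sup_right) le_sup_left)

theorem LatTerm.eval_map {V L M : Type*} [Lattice L] [Lattice M] (φ : L → M)
    (hsup : ∀ x y, φ (x ⊔ y) = φ x ⊔ φ y) (hinf : ∀ x y, φ (x ⊓ y) = φ x ⊓ φ y)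
    (v : V → L) (t : LatTerm V) : φ (t.eval v) = t.eval (φ ∘ v) := by
  induction t with
  | var x => rfl
  | inf s t hs ht => simp only [LatTerm.eval, hinf, hs, ht]
  | sup s t hs ht => simp only [LatTerm.eval, hsup, hs, ht]

/-- Varieties are closed under sublattices. -/
theorem InVariety.of_injective {E : Set LatIdentity} {L M : Type*} [Lattice L] [Lattice M]
    (hM : InVariety E M) (φ : L → M) (hφ : Function.Injective φ)
    (hsup : ∀ x y, φ (x ⊔ y) = φ x ⊔ φ y) (hinf : ∀ x y, φ (x ⊓ y) = φ x ⊓ φ y) :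
    InVariety E L := fun e he v => hφ <| by
  rw [LatTerm.eval_map φ hsup hinf, LatTerm.eval_map φ hsup hinf]
  exact hM e he _

/-- A non-distributive variety has a bounded member in which the cut rule fails for a triple
that meets at the bottom and joins at the top. -/
theorem IsNonDistributiveVariety.exists_bounded {E : Set LatIdentity}
    (hE : IsNonDistributiveVariety.{u} E) :
    ∃ (L : Type u) (_ : Lattice L) (_ : BoundedOrder L), InVariety E L ∧
      ∃ x y z : L, x ⊓ y = ⊥ ∧ y ⊔ z = ⊤ ∧ ¬ x ≤ z := by
  obtain ⟨L, _, hL, hd⟩ := hE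
  have : ∃ x y z : L, x ⊓ y ≤ z ∧ x ≤ y ⊔ z ∧ ¬ x ≤ z := by
    by_contra! h
    exact hd (inf_sup_eq_of_cut h)
  obtain ⟨x, y, z, h₁, h₂, h₃⟩ := this
  -- A failure of the cut rule lies inside the interval from `x ⊓ y` to `y ⊔ z`.
  have : Fact (x ⊓ y ≤ y ⊔ z) := ⟨inf_le_right.trans le_sup_left⟩
  exact ⟨Set.Icc (x ⊓ y) (y ⊔ z), inferInstance, inferInstance,
    hL.of_injective Subtype.val Subtype.val_injective (fun _ _ => rfl) (fun _ _ => rfl),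
    ⟨x, inf_le_left, h₂⟩, ⟨y, inf_le_right, le_sup_left⟩, ⟨z, h₁, le_sup_right⟩,
    rfl, rfl, h₃⟩

/-! ### Free bounded lattices -/

namespace IsFreeBoundedLattice

variable {E : Set LatIdentity} {X F : Type u} [Lattice F] [BoundedOrder F] {gen : X → F}

theorem comp_equiv (hF : IsFreeBoundedLattice E gen) {Y : Type u} (e : Y ≃ X) :
    IsFreeBoundedLattice E (gen ∘ e) := by
  refine ⟨hF.1, fun L _ _ hL f => ?_⟩
  obtain ⟨g, hg, hu⟩ := hF.2 L hL (f ∘ e.symm)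
  refine ⟨g, fun y => by simp [hg], fun g' hg' => hu g' fun x => ?_⟩
  simpa using hg' (e.symm x)

/-- A free bounded lattice is generated by its generators. -/
theorem induction (hF : IsFreeBoundedLattice E gen) {P : F → Prop} (bot : P ⊥) (top : P ⊤)
    (sup : ∀ ⦃s t⦄, P s → P t → P (s ⊔ t)) (inf : ∀ ⦃s t⦄, P s → P t → P (s ⊓ t))
    (var : ∀ x, P (gen x)) (s : F) : P s := by
  let _ : Lattice {s // P s} := Subtype.lattice sup inf
  let _ : BoundedOrder {s // P s} := Subtype.boundedOrder bot top
  have hP : InVariety E {s // P s} :=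
    hF.1.of_injective Subtype.val Subtype.val_injective (fun _ _ => rfl) (fun _ _ => rfl)
  obtain ⟨g, hg, -⟩ := hF.2 _ hP fun x => ⟨gen x, var x⟩
  let ι : BoundedLatticeHom {s // P s} F :=
    { toFun := Subtype.val, map_sup' := fun _ _ => rfl, map_inf' := fun _ _ => rfl,
      map_top' := rfl, map_bot' := rfl }
  have h : ι.comp g = BoundedLatticeHom.id F :=
    (hF.2 F hF.1 gen).unique (fun x => congrArg Subtype.val (hg x)) fun _ => rfl
  have hs : (g s : F) = s := DFunLike.congr_fun h s
  exact hs ▸ (g s).2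

/-- Every compact congruence of a free bounded lattice has a finite support: its triviality under a
homomorphism is decided by the values at finitely many generators. -/
theorem exists_support (hF : IsFreeBoundedLattice E gen) (L : Type*) [Lattice L] [BoundedOrder L]
    {θ : LatticeCon F} (hθ : IsCompactElement θ) :
    ∃ T : Finset X, ∀ φ ψ : BoundedLatticeHom F L, (∀ x ∈ T, φ (gen x) = ψ (gen x)) →
      θ ≤ LatticeCon.ker φ → θ ≤ LatticeCon.ker ψ := by
  classical
  -- A semantic substitute for the sublattice generated by `T`.
  let S : Finset X → Set F := fun T =>
    {s | ∀ φ ψ : BoundedLatticeHom F L, (∀ x ∈ T, φ (gen x) = ψ (gen x)) → φ s = ψ s}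
  have hS : Monotone S := fun T T' h s hs φ ψ hφψ => hs φ ψ fun x hx => hφψ x (h hx)
  have hmem : ∀ s, ∃ T, s ∈ S T := by
    refine hF.induction ⟨∅, fun φ ψ _ => by simp⟩ ⟨∅, fun φ ψ _ => by simp⟩ ?_ ?_
      fun x => ⟨{x}, fun φ ψ h => h x (by simp)⟩
    · rintro s t ⟨T, hT⟩ ⟨T', hT'⟩
      refine ⟨T ∪ T', fun φ ψ h => ?_⟩
      rw [map_sup, map_sup, hS Finset.subset_union_left hT φ ψ h,
        hS Finset.subset_union_right hT' φ ψ h]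
    · rintro s t ⟨T, hT⟩ ⟨T', hT'⟩
      refine ⟨T ∪ T', fun φ ψ h => ?_⟩
      rw [map_inf, map_inf, hS Finset.subset_union_left hT φ ψ h,
        hS Finset.subset_union_right hT' φ ψ h]
  -- The congruence generated by the restriction of `θ` to `S T`; these are directed with join above
  -- `θ`, so compactness selects one `T`.
  let C : Finset X → LatticeCon F := fun T =>
    sInf {κ | ∀ s ∈ S T, ∀ t ∈ S T, θ.r s t → κ.r s t}
  have hC : Monotone C := fun T T' h =>
    sInf_le_sInf fun κ hκ s hs t ht => hκ s (hS h hs) t (hS h ht)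
  have hle : θ ≤ sSup (Set.range C) := by
    intro s t hst
    obtain ⟨T, hT⟩ := hmem s
    obtain ⟨T', hT'⟩ := hmem t
    have h : C (T ∪ T') ≤ sSup (Set.range C) := le_sSup (Set.mem_range_self _)
    exact h s t fun κ hκ => hκ s (hS Finset.subset_union_left hT) t (hS Finset.subset_union_right hT') hst
  obtain ⟨_, ⟨T, rfl⟩, hT⟩ := hθ _ _ (Set.range_nonempty C)
    (directedOn_range.2 hC.directed_le) (isLUB_sSup _) hle
  refine ⟨T, fun φ ψ h hφ => hT.trans (sInf_le fun s hs t ht hst => ?_)⟩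
  have hst' : φ s = φ t := hφ s t hst
  exact (hs φ ψ h).symm.trans (hst'.trans (ht φ ψ h))

end IsFreeBoundedLattice

/-! ### Congruences associated with pairs of generators -/

section Pairs

variable {E : Set LatIdentity} {I F L : Type u} [Lattice F] [BoundedOrder F] [Lattice L]
  [BoundedOrder L] {gen : I × Bool → F}

/-- The homomorphism `φ` sends the meet and the join of the `i`-th pair of generators
to `p.1` and `p.2`. -/
def SendsPair (gen : I × Bool → F) (φ : BoundedLatticeHom F L) (i : I) (p : L × L) : Prop :=
  φ (gen (i, false)) = p.1 ∧ φ (gen (i, true)) = p.2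

/-- The congruence that collapses the interval spanned by the `i`-th pair of generators. -/
def pairInner (gen : I × Bool → F) (i : I) : ConC F :=
  ConC.principal (gen (i, false) ⊓ gen (i, true)) (gen (i, false) ⊔ gen (i, true))

/-- The congruence that collapses the intervals below and above the `i`-th pair of generators. -/
def pairOuter (gen : I × Bool → F) (i : I) : ConC F :=
  ConC.principal ⊥ (gen (i, false) ⊓ gen (i, true)) ⊔
    ConC.principal (gen (i, false) ⊔ gen (i, true)) ⊤

theorem le_principal_bot_top (θ : LatticeCon F) : θ ≤ LatticeCon.principal (⊥ : F) ⊤ := by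
  have h : ∀ x : F, (LatticeCon.principal (⊥ : F) ⊤).r ⊥ x := fun x κ hκ => by
    simpa using κ.inf hκ (κ.iseqv.refl x)
  exact fun x y _ => (LatticeCon.principal (⊥ : F) ⊤).iseqv.trans
    ((LatticeCon.principal (⊥ : F) ⊤).iseqv.symm (h x)) (h y)

/-- Outer, inner and outer steps link `⊥`, the meet of the pair, its join and `⊤`. -/
theorem pairInner_sup_pairOuter (gen : I × Bool → F) (i : I) :
    pairInner gen i ⊔ pairOuter gen i = ConC.principal ⊥ ⊤ := by
  refine Subtype.ext (le_antisymm (le_principal_bot_top _) (LatticeCon.principal_le_iff.2 ?_))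
  set κ : LatticeCon F := (pairInner gen i ⊔ pairOuter gen i).1
  have h₁ := LatticeCon.principal_le_iff.1 (show _ ≤ κ from le_sup_left)
  have h₂ : pairOuter gen i ≤ pairInner gen i ⊔ pairOuter gen i := le_sup_right
  have h₃ := LatticeCon.principal_le_iff.1 (show _ ≤ κ from le_sup_left.trans h₂)
  have h₄ := LatticeCon.principal_le_iff.1 (show _ ≤ κ from le_sup_right.trans h₂)
  exact κ.iseqv.trans h₃ (κ.iseqv.trans h₁ h₄)

theorem pairInner_le_ker {φ : BoundedLatticeHom F L} {i : I} {c : L}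
    (h : SendsPair gen φ i (c, c)) : (pairInner gen i).1 ≤ LatticeCon.ker φ := by
  refine LatticeCon.principal_le_iff.2 ?_
  change φ _ = φ _
  simp [h.1, h.2]

theorem pairOuter_le_ker {φ : BoundedLatticeHom F L} {i : I}
    (h : SendsPair gen φ i (⊥, ⊤)) : (pairOuter gen i).1 ≤ LatticeCon.ker φ := by
  refine sup_le (LatticeCon.principal_le_iff.2 ?_) (LatticeCon.principal_le_iff.2 ?_) <;>
  · change φ _ = φ _
    simp [h.1, h.2]

namespace IsFreeBoundedLattice

theorem exists_sendsPair (hF : IsFreeBoundedLattice E gen) (hL : InVariety E L) (p : I → L × L) :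
    ∃ φ : BoundedLatticeHom F L, ∀ i, SendsPair gen φ i (p i) := by
  obtain ⟨φ, hφ, -⟩ := hF.2 L hL fun q => if q.2 then (p q.1).2 else (p q.1).1
  exact ⟨φ, fun i => ⟨by simp [hφ], by simp [hφ]⟩⟩

/-- A congruence below `pairInner gen i` and `pairOuter gen j` is trivial under a homomorphism that
sends the `i`-th pair to
`(⊥, x)`, the `j`-th pair to `(y, ⊤)` with `x ⊓ y = ⊥` and the other pairs to `⊥`. -/
theorem le_ker_of_inf_eq_bot (hF : IsFreeBoundedLattice E gen) (hL : InVariety E L)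
    {i j : I} (hij : i ≠ j) {x y : L} (hxy : x ⊓ y = ⊥) {γ : LatticeCon F}
    (hi : γ ≤ (pairInner gen i).1) (hj : γ ≤ (pairOuter gen j).1) {ψ : BoundedLatticeHom F L}
    (hψi : SendsPair gen ψ i (⊥, x)) (hψj : SendsPair gen ψ j (y, ⊤))
    (hψ : ∀ l, l ≠ i → l ≠ j → SendsPair gen ψ l (⊥, ⊥)) : γ ≤ LatticeCon.ker ψ := by
  classical
  have hji := hij.symm
  have key : ∀ ci cj : L × L, ∃ π : BoundedLatticeHom F L, SendsPair gen π i ci ∧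
      SendsPair gen π j cj ∧ ∀ l, l ≠ i → l ≠ j → SendsPair gen π l (⊥, ⊥) := by
    intro ci cj
    obtain ⟨π, hπ⟩ := hF.exists_sendsPair hL
      fun l => if l = i then ci else if l = j then cj else (⊥, ⊥)
    refine ⟨π, by simpa using hπ i, by simpa [hji] using hπ j, fun l h h' => ?_⟩
    simpa [h, h'] using hπ l
  -- Three maps into `{⊥, ⊤}`, each killing `γ`: the first collapses the outside of pair `j`, the
  -- others the inside of pair `i`. The table `hP` shows that together they determine `ψ`.
  obtain ⟨π₁, h₁i, h₁j, h₁⟩ := key (⊥, ⊤) (⊥, ⊤)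
  obtain ⟨π₂, h₂i, h₂j, h₂⟩ := key (⊥, ⊥) (⊤, ⊤)
  obtain ⟨π₃, h₃i, h₃j, h₃⟩ := key (⊥, ⊥) (⊥, ⊤)
  have hyx : y ⊓ x = ⊥ := by rw [inf_comm, hxy]
  have hP : ∀ s, (ψ s = ⊥ ∧ π₁ s = ⊥ ∧ π₂ s = ⊥ ∧ π₃ s = ⊥) ∨
      (ψ s = x ∧ π₁ s = ⊤ ∧ π₂ s = ⊥ ∧ π₃ s = ⊥) ∨
      (ψ s = y ∧ π₁ s = ⊥ ∧ π₂ s = ⊤ ∧ π₃ s = ⊥) ∨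
      (ψ s = x ⊔ y ∧ π₁ s = ⊤ ∧ π₂ s = ⊤ ∧ π₃ s = ⊥) ∨
      (ψ s = ⊤ ∧ π₁ s = ⊤ ∧ π₂ s = ⊤ ∧ π₃ s = ⊤) := by
    refine hF.induction (by simp) (by simp) ?_ ?_ ?_
    · rintro s t (h | h | h | h | h) (h' | h' | h' | h' | h') <;>
      simp [h, h', sup_comm y x]
    · rintro s t (h | h | h | h | h) (h' | h' | h' | h' | h') <;>
      simp [h, h', hxy, hyx]
    · rintro ⟨l, b⟩
      rcases eq_or_ne l i with rfl | hli
      · cases b <;> simp [hψi.1, hψi.2, h₁i.1, h₁i.2, h₂i.1, h₂i.2, h₃i.1, h₃i.2]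
      rcases eq_or_ne l j with rfl | hlj
      · cases b <;> simp [hψj.1, hψj.2, h₁j.1, h₁j.2, h₂j.1, h₂j.2, h₃j.1, h₃j.2]
      · have e := hψ l hli hlj
        have e₁ := h₁ l hli hlj
        have e₂ := h₂ l hli hlj
        have e₃ := h₃ l hli hlj
        cases b <;> simp [e.1, e.2, e₁.1, e₁.2, e₂.1, e₂.2, e₃.1, e₃.2]
  intro s t hst
  have e₁ : π₁ s = π₁ t := hj.trans (pairOuter_le_ker h₁j) s t hst
  have e₂ : π₂ s = π₂ t := hi.trans (pairInner_le_ker h₂i) s t hst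
  have e₃ : π₃ s = π₃ t := hi.trans (pairInner_le_ker h₃i) s t hst
  show ψ s = ψ t
  rcases subsingleton_or_nontrivial L with _ | _
  · exact Subsingleton.elim _ _
  rcases hP s with h | h | h | h | h <;> rcases hP t with h' | h' | h' | h' | h' <;>
  rw [h.2.1, h'.2.1] at e₁ <;> rw [h.2.2.1, h'.2.2.1] at e₂ <;>
  rw [h.2.2.2, h'.2.2.2] at e₃ <;>
  first
  | exact absurd e₁ bot_ne_top | exact absurd e₁ top_ne_bot
  | exact absurd e₂ bot_ne_top | exact absurd e₂ top_ne_bot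
  | exact absurd e₃ bot_ne_top | exact absurd e₃ top_ne_bot
  | rw [h.1, h'.1]

/-- A congruence below `pairInner gen i` and `pairOuter gen j` is trivial under a homomorphism that
sends the `i`-th pair to
`(y, ⊤)`, the `j`-th pair to `(⊥, z)` with `y ⊔ z = ⊤` and the other pairs to `⊥`. -/
theorem le_ker_of_sup_eq_top (hF : IsFreeBoundedLattice E gen) (hL : InVariety E L)
    {i j : I} (hij : i ≠ j) {y z : L} (hyz : y ⊔ z = ⊤) {γ : LatticeCon F}
    (hi : γ ≤ (pairInner gen i).1) (hj : γ ≤ (pairOuter gen j).1) {ψ : BoundedLatticeHom F L}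
    (hψi : SendsPair gen ψ i (y, ⊤)) (hψj : SendsPair gen ψ j (⊥, z))
    (hψ : ∀ l, l ≠ i → l ≠ j → SendsPair gen ψ l (⊥, ⊥)) : γ ≤ LatticeCon.ker ψ := by
  classical
  have hji := hij.symm
  have key : ∀ ci cj : L × L, ∃ π : BoundedLatticeHom F L, SendsPair gen π i ci ∧
      SendsPair gen π j cj ∧ ∀ l, l ≠ i → l ≠ j → SendsPair gen π l (⊥, ⊥) := by
    intro ci cj
    obtain ⟨π, hπ⟩ := hF.exists_sendsPair hL
      fun l => if l = i then ci else if l = j then cj else (⊥, ⊥)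
    refine ⟨π, by simpa using hπ i, by simpa [hji] using hπ j, fun l h h' => ?_⟩
    simpa [h, h'] using hπ l
  obtain ⟨π₁, h₁i, h₁j, h₁⟩ := key (⊤, ⊤) (⊥, ⊥)
  obtain ⟨π₂, h₂i, h₂j, h₂⟩ := key (⊥, ⊤) (⊥, ⊤)
  obtain ⟨π₃, h₃i, h₃j, h₃⟩ := key (⊤, ⊤) (⊥, ⊤)
  -- Again three two-valued maps determine `ψ`; `y ⊔ z = ⊤` closes the table under joins.
  have hzy : z ⊔ y = ⊤ := by rw [sup_comm, hyz]
  have hP : ∀ s, (ψ s = ⊥ ∧ π₁ s = ⊥ ∧ π₂ s = ⊥ ∧ π₃ s = ⊥) ∨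
      (ψ s = y ⊓ z ∧ π₁ s = ⊥ ∧ π₂ s = ⊥ ∧ π₃ s = ⊤) ∨
      (ψ s = y ∧ π₁ s = ⊤ ∧ π₂ s = ⊥ ∧ π₃ s = ⊤) ∨
      (ψ s = z ∧ π₁ s = ⊥ ∧ π₂ s = ⊤ ∧ π₃ s = ⊤) ∨
      (ψ s = ⊤ ∧ π₁ s = ⊤ ∧ π₂ s = ⊤ ∧ π₃ s = ⊤) := by
    refine hF.induction (by simp) (by simp) ?_ ?_ ?_
    · rintro s t (h | h | h | h | h) (h' | h' | h' | h' | h') <;>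
      simp [h, h', hyz, hzy]
    · rintro s t (h | h | h | h | h) (h' | h' | h' | h' | h') <;>
      simp [h, h', inf_comm z y]
    · rintro ⟨l, b⟩
      rcases eq_or_ne l i with rfl | hli
      · cases b <;> simp [hψi.1, hψi.2, h₁i.1, h₁i.2, h₂i.1, h₂i.2, h₃i.1, h₃i.2]
      rcases eq_or_ne l j with rfl | hlj
      · cases b <;> simp [hψj.1, hψj.2, h₁j.1, h₁j.2, h₂j.1, h₂j.2, h₃j.1, h₃j.2]
      · have e := hψ l hli hlj
        have e₁ := h₁ l hli hlj
        have e₂ := h₂ l hli hlj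
        have e₃ := h₃ l hli hlj
        cases b <;> simp [e.1, e.2, e₁.1, e₁.2, e₂.1, e₂.2, e₃.1, e₃.2]
  intro s t hst
  have e₁ : π₁ s = π₁ t := hi.trans (pairInner_le_ker h₁i) s t hst
  have e₂ : π₂ s = π₂ t := hj.trans (pairOuter_le_ker h₂j) s t hst
  have e₃ : π₃ s = π₃ t := hi.trans (pairInner_le_ker h₃i) s t hst
  show ψ s = ψ t
  rcases subsingleton_or_nontrivial L with _ | _
  · exact Subsingleton.elim _ _
  rcases hP s with h | h | h | h | h <;> rcases hP t with h' | h' | h' | h' | h' <;>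
  rw [h.2.1, h'.2.1] at e₁ <;> rw [h.2.2.1, h'.2.2.1] at e₂ <;>
  rw [h.2.2.2, h'.2.2.2] at e₃ <;>
  first
  | exact absurd e₁ bot_ne_top | exact absurd e₁ top_ne_bot
  | exact absurd e₂ bot_ne_top | exact absurd e₂ top_ne_bot
  | exact absurd e₃ bot_ne_top | exact absurd e₃ top_ne_bot
  | rw [h.1, h'.1]

/-- A congruence that links a refinement of the `i`-th and `j`-th decompositions of the largest
congruence is not trivial under a homomorphism that sends the `i`-th pair to `(⊥, x)`, the `j`-th
pair to `(⊥, z)` with `¬ x ≤ z` and the other pairs to `⊥`. -/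
theorem not_le_ker_of_not_le (hF : IsFreeBoundedLattice E gen) (hL : InVariety E L)
    {i j : I} (hij : i ≠ j) {x z : L} (hxz : ¬ x ≤ z) {α β α' γ : ConC F}
    (hβ : β ≤ pairOuter gen i) (hαβ : α ⊔ β = ConC.principal ⊥ ⊤) (hα' : α' ≤ pairInner gen j)
    (hγ : α ≤ α' ⊔ γ) {ψ : BoundedLatticeHom F L}
    (hψi : SendsPair gen ψ i (⊥, x)) (hψj : SendsPair gen ψ j (⊥, z))
    (hψ : ∀ l, l ≠ i → l ≠ j → SendsPair gen ψ l (⊥, ⊥)) : ¬ γ.1 ≤ LatticeCon.ker ψ := by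
  classical
  intro hle
  -- `π` kills `α'` and `β`. Since `¬ x ≤ z`, the value of `ψ` determines that of `π`, so `π` would
  -- also kill `γ`, hence `α` and finally `Θ(0,1)`.
  obtain ⟨π, hπ⟩ := hF.exists_sendsPair hL fun l => if l = i then (⊥, ⊤) else (⊥, ⊥)
  have hπi : SendsPair gen π i (⊥, ⊤) := by simpa using hπ i
  have hπ' : ∀ l, l ≠ i → SendsPair gen π l (⊥, ⊥) := fun l h => by simpa [h] using hπ l
  have hP : ∀ s, (π s = ⊤ ∧ x ≤ ψ s) ∨ (π s = ⊥ ∧ ψ s ≤ z) := by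
    refine hF.induction (by simp) (by simp) ?_ ?_ ?_
    · rintro s t (h | h) (h' | h') <;>
      simp [h, h', le_sup_of_le_left, le_sup_of_le_right]
    · rintro s t (h | h) (h' | h') <;>
      simp [h, h', inf_le_of_left_le, inf_le_of_right_le]
    · rintro ⟨l, b⟩
      rcases eq_or_ne l i with rfl | hli
      · cases b <;> simp [hψi.1, hψi.2, hπi.1, hπi.2]
      have e := hπ' l hli
      rcases eq_or_ne l j with rfl | hlj
      · cases b <;> simp [hψj.1, hψj.2, e.1, e.2]
      · cases b <;> simp [(hψ l hli hlj).1, (hψ l hli hlj).2, e.1, e.2]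
  have hγπ : γ.1 ≤ LatticeCon.ker π := by
    intro s t hst
    have hψst : ψ s = ψ t := hle s t hst
    show π s = π t
    rcases hP s with h | h <;> rcases hP t with h' | h'
    · rw [h.1, h'.1]
    · exact absurd (h.2.trans (hψst.le.trans h'.2)) hxz
    · exact absurd (h'.2.trans (hψst.ge.trans h.2)) hxz
    · rw [h.1, h'.1]
  have hα'π : α'.1 ≤ LatticeCon.ker π :=
    le_trans (show α'.1 ≤ (pairInner gen j).1 from hα') (pairInner_le_ker (hπ' j hij.symm))
  have hβπ : β.1 ≤ LatticeCon.ker π :=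
    le_trans (show β.1 ≤ (pairOuter gen i).1 from hβ) (pairOuter_le_ker hπi)
  have hαπ : α.1 ≤ LatticeCon.ker π :=
    le_trans (show α.1 ≤ α'.1 ⊔ γ.1 from hγ) (sup_le hα'π hγπ)
  have hε : LatticeCon.principal (⊥ : F) ⊤ ≤ LatticeCon.ker π :=
    (congrArg Subtype.val hαβ).symm.le.trans (sup_le hαπ hβπ)
  have h01 : π ⊥ = π ⊤ := LatticeCon.principal_le_iff.1 hε
  rw [map_bot, map_top] at h01
  exact hxz (le_top.trans (h01.symm.le.trans bot_le))

/-- The family of decompositions given by at least `ℵ₂` pairs of generators violates `URP₁⁻`. -/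
theorem not_satisfiesURPOneMinusAtFamily (hF : IsFreeBoundedLattice E gen)
    (hE : IsNonDistributiveVariety.{u} E) (hI : Cardinal.aleph 2 ≤ #I) :
    ¬ SatisfiesURPOneMinusAtFamily (ConC.principal (⊥ : F) ⊤) (pairInner gen)
      (pairOuter gen) := by
  classical
  rintro ⟨X, α, β, γ, h₁, h₂, h₃, h₄⟩
  obtain ⟨L, _, _, hL, x, y, z, hxy, hyz, hxz⟩ := hE.exists_bounded
  choose T hT using fun i j => hF.exists_support L (γ i j).2
  let G : I → I → Finset I := fun i j => (T i j).image Prod.fst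
  have hG : ∀ i j (φ ψ : BoundedLatticeHom F L) (p : I → L × L),
      (∀ l ∈ G i j, SendsPair gen φ l (p l)) → (∀ l ∈ G i j, SendsPair gen ψ l (p l)) →
      (γ i j).1 ≤ LatticeCon.ker φ → (γ i j).1 ≤ LatticeCon.ker ψ := by
    intro i j φ ψ p hφ hψ
    refine hT i j φ ψ ?_
    rintro ⟨l, b⟩ hl
    have hl' : l ∈ G i j := Finset.mem_image.2 ⟨_, hl, rfl⟩
    cases b
    · rw [(hφ l hl').1, (hψ l hl').1]
    · rw [(hφ l hl').2, (hψ l hl').2]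
  have main : ∀ i j k, i ≠ j → i ≠ k → j ≠ k → k ∉ G i j → i ∉ G j k → j ∉ G i k →
      ¬ γ i k ≤ γ i j ⊔ γ j k := by
    intro i j k hij hik hjk hk hi hj hle
    let p : I → L × L := fun l =>
      if l = i then (⊥, x) else if l = j then (y, ⊤) else if l = k then (⊥, z) else (⊥, ⊥)
    have hpi : p i = (⊥, x) := by simp [p]
    have hpj : p j = (y, ⊤) := by simp [p, hij.symm]
    have hpk : p k = (⊥, z) := by simp [p, hik.symm, hjk.symm]
    have hp : ∀ l, l ≠ i → l ≠ j → l ≠ k → p l = (⊥, ⊥) := fun l a b c => by simp [p, a, b, c]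
    have drop : ∀ m, ∃ ψ : BoundedLatticeHom F L, SendsPair gen ψ m (⊥, ⊥) ∧
        ∀ l, l ≠ m → SendsPair gen ψ l (p l) := by
      intro m
      obtain ⟨ψ, hψ⟩ := hF.exists_sendsPair hL fun l => if l = m then (⊥, ⊥) else p l
      exact ⟨ψ, by simpa using hψ m, fun l h => by simpa [h] using hψ l⟩
    obtain ⟨φ, hφ⟩ := hF.exists_sendsPair hL p
    have hγij : (γ i j).1 ≤ LatticeCon.ker φ := by
      obtain ⟨ψ, hψk, hψ⟩ := drop k
      refine hG i j ψ φ p (fun l hl => hψ l fun h => hk (h ▸ hl)) (fun l _ => hφ l) ?_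
      refine hF.le_ker_of_inf_eq_bot hL hij hxy ((h₂ i j).1.trans (h₁ i).1)
        ((h₂ i j).2.trans (h₁ j).2.1) (hpi ▸ hψ i hik) (hpj ▸ hψ j hjk) fun l hli hlj => ?_
      rcases eq_or_ne l k with rfl | hlk
      · exact hψk
      · exact hp l hli hlj hlk ▸ hψ l hlk
    have hγjk : (γ j k).1 ≤ LatticeCon.ker φ := by
      obtain ⟨ψ, hψi, hψ⟩ := drop i
      refine hG j k ψ φ p (fun l hl => hψ l fun h => hi (h ▸ hl)) (fun l _ => hφ l) ?_
      refine hF.le_ker_of_sup_eq_top hL hjk hyz ((h₂ j k).1.trans (h₁ j).1)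
        ((h₂ j k).2.trans (h₁ k).2.1) (hpj ▸ hψ j hij.symm) (hpk ▸ hψ k hik.symm)
        fun l hlj hlk => ?_
      rcases eq_or_ne l i with rfl | hli
      · exact hψi
      · exact hp l hli hlj hlk ▸ hψ l hli
    obtain ⟨ψ, hψj, hψ⟩ := drop j
    refine hF.not_le_ker_of_not_le hL hik hxz (h₁ i).2.1 (h₁ i).2.2 (h₁ k).1 (h₃ i k).1
      (hpi ▸ hψ i hij) (hpk ▸ hψ k hjk.symm) (fun l hli hlk => ?_)
      (hG i k φ ψ p (fun l _ => hφ l) (fun l hl => hψ l fun h => hj (h ▸ hl))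
        (le_trans (show (γ i k).1 ≤ (γ i j).1 ⊔ (γ j k).1 from hle) (sup_le hγij hγjk)))
    rcases eq_or_ne l j with rfl | hlj
    · exact hψj
    · exact hp l hli hlj hlk ▸ hψ l hlj
  -- Both orders of indices are included because `i` and `j` may have to be swapped.
  obtain ⟨i, j, k, hij, hik, hjk, hk, hi, hj⟩ :=
    exists_free_triple hI fun i j => G i j ∪ G j i
  simp only [Finset.mem_union, not_or] at hk hi hj
  -- If `j` is on the side of `i` or `k`, (iv) applies to `i, j, k`. Otherwise `i` and `k` are on
  -- the same side, and it applies to `j, i, k`.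
  by_cases h : (j ∈ X ↔ i ∈ X) ∨ (j ∈ X ↔ k ∈ X)
  · refine main i j k hij hik hjk hk.1 hi.1 hj.1 (h₄ i j k ?_)
    simp only [Set.insert_subset_iff, Set.singleton_subset_iff, Set.mem_compl_iff]
    tauto
  · refine main j i k hij.symm hjk hik hk.2 hj.1 hi.1 (h₄ j i k ?_)
    simp only [Set.insert_subset_iff, Set.singleton_subset_iff, Set.mem_compl_iff]
    tauto

end IsFreeBoundedLattice

end Pairs

theorem mainTheorem7 (E : Set LatIdentity) (hE : IsNonDistributiveVariety.{u} E)
    (X F : Type u) [Lattice F] [BoundedOrder F] (gen : X → F)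
    (hF : IsFreeBoundedLattice E gen) (hX : Cardinal.aleph 2 ≤ Cardinal.mk X) :
    (∀ θ : LatticeCon F, θ ≤ LatticeCon.principal (⊥ : F) ⊤) ∧
      ¬ SatisfiesURPOneMinusAt (ConC.principal (⊥ : F) ⊤) := by
  refine ⟨le_principal_bot_top, fun h => ?_⟩
  -- As `X` is infinite, its elements can be regrouped into pairs indexed by `X` itself.
  have hX0 : ℵ₀ ≤ #X := (Cardinal.aleph0_le_aleph 2).trans hX
  have hcard : #(X × Bool) = #X := by
    rw [Cardinal.mk_prod, Cardinal.mk_bool]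
    simpa using Cardinal.mul_eq_left hX0 ((Cardinal.natCast_lt_aleph0 (n := 2)).le.trans hX0)
      two_ne_zero
  obtain ⟨e⟩ := Cardinal.eq.1 hcard
  exact (hF.comp_equiv e).not_satisfiesURPOneMinusAtFamily hE hX
    (h X _ _ (pairInner_sup_pairOuter (gen ∘ e)))
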